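/- Let $\alpha,\beta,\gamma,\delta,\epsilon,t,q\in\mathbb C$ with $t\neq 0,1$ and $\gamma+\delta+\epsilon=\alpha+\beta+1$, and consider Heun's differential equation $$\frac{d^2y}{dz^2}+\left(\frac{\gamma}{z}+\frac{\delta}{z-1}+\frac{\epsilon}{z-t}\right)\frac{dy}{dz}+\frac{\alpha\beta z-q}{z(z-1)(z-t)}\,y=0 .\qquad (*)$$ Assume that $\epsilon\in\mathbb Z_{\le 0}$, $\alpha\in\mathbb Z_{\le 0}$ and $\beta\notin\mathbb Z_{\le 0}$. The singularity $z=t$, whose exponents are $0$ and $1-\epsilon$, is called apparent if there is no logarithmic term in the local solutions at $t$, i.e. if near $z=t$ there is a basis of solutions $f(z)=\sum_{j\ge0}c_j(z-t)^j$, $c_0\ne0$, and $g(z)=(z-t)^{1-\epsilon}\sum_{j\ge0}\tilde c_j(z-t)^j$, $\tilde c_0\neq0$ (convergent power series). Define polynomials $d_i(q)$, monic of degree $i$ in $q$, by $d_0=1$, $d_1=q-\alpha\beta t$ and, for $i\ge 2$, $$d_i=-\big[(i-1)(i-2)(2t-1)+(i-1)\{(\gamma+\delta+2\epsilon)t-\gamma-\epsilon\}+\alpha\beta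 t-q\big]d_{i-1}-(i-1)(i+\epsilon-2)\,t(t-1)\,(i+\alpha-2)(i+\beta-2)\,d_{i-2}$$ (the coefficients of the power series solution of $(*)$ at $z=t$ with constant term $1$, with denominators cleared), and put $P^{\mathsf{pol}}=d_{1-\alpha}$ and $P^{\mathsf{app}}=d_{1-\epsilon}$. Then $(*)$ has a non-zero polynomial solution if and only if $P^{\mathsf{pol}}(q)=0$, the singularity $z=t$ is apparent if and only if $P^{\mathsf{app}}(q)=0$, and the following hold. (i) If $-\alpha\le-\epsilon$ and $(*)$ has a non-zero polynomial solution (i.e. $P^{\mathsf{pol}}(q)=0$), then the singularity $z=t$ is apparent (i.e. $P^{\mathsf{app}}(q)=0$). (ii) If $-\epsilon\le-\alpha$ and the singularity $z=t$ is apparent (i.e. $P^{\mathsf{app}}(q)=0$), then $(*)$ has a non-zero polynomial solution (i.e. $P^{\mathsf{pol}}(q)=0$). -/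

import Mathlib

noncomputable section

open Filter Topology

/-- The left-hand side of Heun's differential equation at the point `z`:
`y'' + (γ/z + δ/(z-1) + ε/(z-t)) y' + (αβz - q)/(z(z-1)(z-t)) y`. -/
def heunLHS (α β γ δ ε t q : ℂ) (y : ℂ → ℂ) (z : ℂ) : ℂ :=
  deriv (deriv y) z + (γ / z + δ / (z - 1) + ε / (z - t)) * deriv y z
    + (α * β * z - q) / (z * (z - 1) * (z - t)) * y z

/-- Heun's equation has a non-zero polynomial solution. -/
def HasPolynomialSolution (α β γ δ ε t q : ℂ) : Prop :=
  ∃ p : Polynomial ℂ, p ≠ 0 ∧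
    ∀ z : ℂ, z ≠ 0 → z ≠ 1 → z ≠ t →
      heunLHS α β γ δ ε t q (fun w => p.eval w) z = 0

/-- The singularity `z = t` is apparent. For an integer `ε ≤ 0` the exponents at `t` are `0` and
`1 - ε`, and there is a basis of local solutions `f = φ + A g log (z - t)`, `φ` holomorphic at `t`
with `φ t ≠ 0`, and `g = (z - t)^(1 - ε) h`, `h` holomorphic at `t` with `h t ≠ 0`. Apparency means
that the logarithmic term is absent, i.e. that there is such a basis with `A = 0`. -/
def IsApparentAt (α β γ δ : ℂ) (ε : ℤ) (t q : ℂ) : Prop :=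
  ∃ f h : ℂ → ℂ,
    AnalyticAt ℂ f t ∧ f t ≠ 0 ∧
    AnalyticAt ℂ h t ∧ h t ≠ 0 ∧
    (∀ᶠ z in 𝓝[≠] t, heunLHS α β γ δ ε t q f z = 0) ∧
    (∀ᶠ z in 𝓝[≠] t,
      heunLHS α β γ δ ε t q (fun w => (w - t) ^ (1 - ε) * h w) z = 0)

/-- Substituting `∑ cᵢ (z - t)ⁱ`, `c₀ = 1`, into Heun's equation gives the recursion
`ε t (t-1) c₁ + (αβt - q) c₀ = 0` and, for `i ≥ 2`,
`i (i+ε-1) t (t-1) cᵢ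
  + [(i-1)(i-2)(2t-1) + (i-1)((γ+δ+2ε)t - γ - ε) + αβt - q] cᵢ₋₁ + (i+α-2)(i+β-2) cᵢ₋₂ = 0`.
`heunCoeff … i` is `cᵢ` with its denominator cleared, `(∏_{j=1}^{i} j (j+ε-1) t (t-1)) cᵢ`, as a
polynomial in the accessory parameter `q` (the variable `X`); it is monic of degree `i`. -/
def heunCoeff (α β γ δ ε t : ℂ) : ℕ → Polynomial ℂ
  | 0 => 1
  | 1 => Polynomial.X - Polynomial.C (α * β * t)
  | (i + 2) =>
      (Polynomial.X - Polynomial.C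
        (((i : ℂ) + 1) * i * (2 * t - 1)
          + ((i : ℂ) + 1) * ((γ + δ + 2 * ε) * t - γ - ε) + α * β * t))
        * heunCoeff α β γ δ ε t (i + 1)
      - Polynomial.C
        (((i : ℂ) + 1) * (i + ε) * (t * (t - 1)) * (i + α) * (i + β))
        * heunCoeff α β γ δ ε t i

/-- The polynomial `P^app` in `q`, monic of degree `1 - ε` (for an integer `ε ≤ 0`). -/
def heunPApp (α β γ δ : ℂ) (ε : ℤ) (t : ℂ) : Polynomial ℂ :=
  heunCoeff α β γ δ ε t (1 - ε).toNat

/-- The polynomial `P^pol` in `q`, monic of degree `1 - α` (for an integer `α ≤ 0`). -/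
def heunPPol (α : ℤ) (β γ δ ε t : ℂ) : Polynomial ℂ :=
  heunCoeff α β γ δ ε t (1 - α).toNat

end

/-!
Expanding at `z = t` turns Heun's operator, cleared of denominators, into an infinite tridiagonal
matrix acting on Taylor coefficients. Up to the sign `(-1) ^ k`, the determinant of its leading
`k × k` block is the value of `heunCoeff α β γ δ ε t k` at `q`, because both satisfy the same
three-term recursion.

If `α = -n`, the subdiagonal entry in column `n` vanishes, so a kernel vector of the block of size
`n + 1`, extended by zero, is in the kernel of the whole matrix: it is the Taylor expansion of a
polynomial solution. Conversely the degree of a polynomial solution is the column of a vanishing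
subdiagonal entry, which is `n` since `β` is not a non-positive integer, so its Taylor coefficients
form a kernel vector of the block. If `ε = -m`, the superdiagonal entry in row `m` vanishes, so the
first `m + 1` rows involve only the first `m + 1` coefficients, whereas all later coefficients
except the one at the exponent `m + 1` are determined by the recursion, whose solutions have a
positive radius of convergence. Hence a solution of exponent `m + 1` always exists, and one of
exponent `0` exists exactly when the block of size `m + 1` is singular. Finally, once an
off-diagonal entry vanishes all larger blocks are block triangular, so the singularity of the
smaller block is inherited by the larger one.
-/

section Tridiagonal

open scoped Matrix

variable {R : Type*} [CommRing R] (A B C : ℕ → R)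

/-- The entries of the infinite tridiagonal matrix with superdiagonal `A`, diagonal `B` and
subdiagonal `C`; the subdiagonal is indexed by columns, so that `A n` and `C n` are symmetric. -/
def tridiagonalEntry (i j : ℕ) : R :=
  (if j = i + 1 then A i else 0) + (if j = i then B i else 0) + (if i = j + 1 then C j else 0)

/-- The leading block of size `N` of an infinite tridiagonal matrix. -/
def tridiagonal (N : ℕ) : Matrix (Fin N) (Fin N) R :=
  .of fun i j => tridiagonalEntry A B C i j

/-- The action of an infinite tridiagonal matrix on sequences. -/
def tridiagonalOp (c : ℕ → R) : ℕ → R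
  | 0 => A 0 * c 1 + B 0 * c 0
  | n + 1 => A (n + 1) * c (n + 2) + B (n + 1) * c (n + 1) + C n * c n

@[simp]
lemma tridiagonalEntry_self_succ (n : ℕ) : tridiagonalEntry A B C n (n + 1) = A n := by
  simp [tridiagonalEntry, show n ≠ n + 1 + 1 by omega]

@[simp]
lemma tridiagonalEntry_self (n : ℕ) : tridiagonalEntry A B C n n = B n := by
  simp [tridiagonalEntry]

@[simp]
lemma tridiagonalEntry_succ_self (n : ℕ) : tridiagonalEntry A B C (n + 1) n = C n := by
  simp [tridiagonalEntry, show n ≠ n + 1 + 1 by omega]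

lemma tridiagonalEntry_eq_zero {i j : ℕ} (h : i + 1 < j ∨ j + 1 < i) :
    tridiagonalEntry A B C i j = 0 := by
  simp [tridiagonalEntry, show j ≠ i + 1 by omega, show j ≠ i by omega, show i ≠ j + 1 by omega]

@[simp]
lemma tridiagonal_apply {N : ℕ} (i j : Fin N) :
    tridiagonal A B C N i j = tridiagonalEntry A B C i j := rfl

lemma tridiagonal_submatrix_castSucc (N : ℕ) :
    (tridiagonal A B C (N + 1)).submatrix Fin.castSucc Fin.castSucc = tridiagonal A B C N := rfl

lemma det_tridiagonal_submatrix_succAbove (N : ℕ) :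
    ((tridiagonal A B C (N + 2)).submatrix Fin.castSucc (Fin.last N).castSucc.succAbove).det =
      A N * (tridiagonal A B C N).det := by
  have hcol (i : Fin N) : (Fin.last N).castSucc.succAbove i.castSucc = i.castSucc.castSucc :=
    Fin.succAbove_of_castSucc_lt _ _ (Fin.castSucc_lt_castSucc_iff.2 i.castSucc_lt_last)
  have hminor : ((tridiagonal A B C (N + 2)).submatrix Fin.castSucc
      (Fin.last N).castSucc.succAbove).submatrix Fin.castSucc Fin.castSucc =
        tridiagonal A B C N := by
    ext i j
    simp [hcol]
  have hentry (i : Fin N) : tridiagonalEntry A B C i (N + 1) = 0 :=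
    tridiagonalEntry_eq_zero _ _ _ (.inl (by simp))
  rw [Matrix.det_succ_column _ (Fin.last N), Fin.sum_univ_castSucc]
  simp [hentry, hminor, Fin.succAbove_last]

lemma det_tridiagonal_add_two (N : ℕ) :
    (tridiagonal A B C (N + 2)).det =
      B (N + 1) * (tridiagonal A B C (N + 1)).det - A N * C N * (tridiagonal A B C N).det := by
  have hentry (j : Fin N) : tridiagonalEntry A B C (N + 1) j = 0 :=
    tridiagonalEntry_eq_zero _ _ _ (.inr (by simp))
  rw [Matrix.det_succ_row _ (Fin.last (N + 1)), Fin.sum_univ_castSucc, Fin.sum_univ_castSucc]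
  simp only [Nat.succ_eq_add_one, Fin.val_last, Fin.val_castSucc, tridiagonal_apply, hentry,
    mul_zero, zero_mul, Finset.sum_const_zero, zero_add, Fin.succAbove_last,
    tridiagonalEntry_succ_self, tridiagonalEntry_self, det_tridiagonal_submatrix_succAbove,
    tridiagonal_submatrix_castSucc, Odd.neg_one_pow (⟨N, by ring⟩ : Odd (N + 1 + N)),
    Even.add_self, Even.neg_pow, one_pow]
  ring

variable {A B C}

lemma det_tridiagonal_eq_zero_of_le {n k : ℕ} (hn : A n * C n = 0)
    (h : (tridiagonal A B C (n + 1)).det = 0) (hk : n + 1 ≤ k) :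
    (tridiagonal A B C k).det = 0 := by
  suffices (tridiagonal A B C k).det = 0 ∧ (tridiagonal A B C (k + 1)).det = 0 from this.1
  induction k, hk using Nat.le_induction with
  | base => simp [det_tridiagonal_add_two, h, hn]
  | succ k hk ih =>
    obtain ⟨k, rfl⟩ := Nat.exists_eq_add_of_le' (le_of_add_le_right hk)
    exact ⟨ih.2, by simp [det_tridiagonal_add_two, ih]⟩

lemma tridiagonalOp_congr {n : ℕ} {c c' : ℕ → R} (h : ∀ k ≤ n + 1, c k = c' k) :
    tridiagonalOp A B C c n = tridiagonalOp A B C c' n := by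
  rcases n with _ | n
  · simp [tridiagonalOp, h]
  · simp [tridiagonalOp, h (n + 2) le_rfl, h (n + 1) (by omega), h n (by omega)]

lemma tridiagonalOp_eq_zero_of_le {m k : ℕ} {c : ℕ → R} (hA : A m = 0) (hc : ∀ j < m + 1, c j = 0)
    (hk : k ≤ m) : tridiagonalOp A B C c k = 0 := by
  have hAc : A k * c (k + 1) = 0 := by
    rcases hk.eq_or_lt with rfl | hk
    · rw [hA, zero_mul]
    · rw [hc _ (by omega), mul_zero]
  rcases k with _ | k
  · rw [tridiagonalOp, hAc, hc 0 (by omega), mul_zero, add_zero]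
  · rw [tridiagonalOp, hAc, hc (k + 1) (by omega), hc k (by omega), mul_zero, mul_zero, add_zero,
      add_zero]

lemma tridiagonalOp_eq_zero_of_lt {n k : ℕ} {c : ℕ → R} (hC : C n = 0) (hc : ∀ j, n < j → c j = 0)
    (hk : n < k) : tridiagonalOp A B C c k = 0 := by
  obtain ⟨k, rfl⟩ := Nat.exists_eq_succ_of_ne_zero (Nat.ne_zero_of_lt hk)
  have hCc : C k * c k = 0 := by
    rcases (Nat.le_of_lt_succ hk).eq_or_lt with rfl | hk
    · rw [hC, zero_mul]
    · rw [hc _ hk, mul_zero]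
  rw [tridiagonalOp, hCc, hc (k + 1) hk, hc (k + 2) (by omega), mul_zero, mul_zero, add_zero,
    add_zero]

lemma sum_range_tridiagonalEntry_mul {i N : ℕ} (h : i + 1 < N) (c : ℕ → R) :
    ∑ j ∈ Finset.range N, tridiagonalEntry A B C i j * c j = tridiagonalOp A B C c i := by
  rcases i with _ | k
  · simp [tridiagonalEntry, tridiagonalOp, add_mul, Finset.sum_add_distrib, h,
      Nat.zero_lt_of_lt h]
  · simp [tridiagonalEntry, tridiagonalOp, add_mul, Finset.sum_add_distrib, h,
      Nat.lt_of_succ_lt h, Nat.lt_of_succ_lt (Nat.lt_of_succ_lt h)]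

lemma tridiagonal_mulVec {n : ℕ} {c : ℕ → R} (hc : A n * c (n + 1) = 0) :
    tridiagonal A B C (n + 1) *ᵥ (fun j : Fin (n + 1) => c j) =
      fun i : Fin (n + 1) => tridiagonalOp A B C c i := by
  ext i
  have hlast : tridiagonalEntry A B C i (n + 1) * c (n + 1) = 0 := by
    rcases i.is_le.eq_or_lt with hi | hi
    · rw [hi, tridiagonalEntry_self_succ, hc]
    · rw [tridiagonalEntry_eq_zero _ _ _ (.inl (by omega)), zero_mul]
  rw [← sum_range_tridiagonalEntry_mul (N := n + 2) (by omega), Finset.sum_range_succ, hlast,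
    add_zero, ← Fin.sum_univ_eq_sum_range fun j => tridiagonalEntry A B C i j * c j]
  rfl

lemma det_tridiagonal_eq_zero_of_tridiagonalOp_eq_zero [IsDomain R] {n k : ℕ} {c : ℕ → R}
    (hc : A n * c (n + 1) = 0) (hop : ∀ i ≤ n, tridiagonalOp A B C c i = 0) (hk : k ≤ n)
    (hck : c k ≠ 0) :
    (tridiagonal A B C (n + 1)).det = 0 := by
  refine Matrix.exists_mulVec_eq_zero_iff.1 ⟨fun j => c j, ?_, ?_⟩
  · exact fun h => hck (congrFun h ⟨k, Nat.lt_succ_of_le hk⟩)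
  · rw [tridiagonal_mulVec hc]
    exact funext fun i => hop i i.is_le

lemma exists_tridiagonalOp_eq_zero [IsDomain R] {n : ℕ} (h : (tridiagonal A B C (n + 1)).det = 0) :
    ∃ c : ℕ → R, (∃ k ≤ n, c k ≠ 0) ∧ (∀ k, n < k → c k = 0) ∧
      ∀ i ≤ n, tridiagonalOp A B C c i = 0 := by
  obtain ⟨v, hv, hker⟩ := Matrix.exists_mulVec_eq_zero_iff.2 h
  obtain ⟨k, hk⟩ := Function.ne_iff.1 hv
  let c : ℕ → R := fun k => if hk : k < n + 1 then v ⟨k, hk⟩ else 0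
  have hcv : (fun j : Fin (n + 1) => c j) = v := funext fun j => dif_pos j.isLt
  have hc0 : ∀ k, n < k → c k = 0 := fun k hk => dif_neg (by omega)
  refine ⟨c, ⟨k, k.is_le, by rwa [congrFun hcv k]⟩, hc0, fun i hi => ?_⟩
  have hmul := tridiagonal_mulVec (A := A) (B := B) (C := C) (n := n) (c := c) (by simp [hc0])
  rw [hcv, hker] at hmul
  exact (congrFun hmul ⟨i, Nat.lt_succ_of_le hi⟩).symm

lemma eq_zero_of_tridiagonalOp_eq_zero [NoZeroDivisors R] {n : ℕ} {c : ℕ → R}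
    (hA : ∀ i < n, A i ≠ 0) (hop : ∀ i < n, tridiagonalOp A B C c i = 0) (h0 : c 0 = 0) {k : ℕ}
    (hk : k ≤ n) : c k = 0 := by
  induction k using Nat.twoStepInduction with
  | zero => exact h0
  | one => simpa [tridiagonalOp, h0, hA 0 hk] using hop 0 hk
  | more k ih ih' =>
    simpa [tridiagonalOp, ih (by omega), ih' (by omega), hA _ hk] using hop (k + 1) hk

end Tridiagonal

section TridiagonalExtend

variable {K : Type*} [Field K]

/-- The sequence that agrees with `v` up to the index `m + 1` and is continued by solving the rows
after the `m`-th one of the tridiagonal system for their last unknown. -/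
def tridiagonalExtend (A B C : ℕ → K) (m : ℕ) (v : ℕ → K) : ℕ → K
  | 0 => v 0
  | 1 => v 1
  | k + 2 =>
    if k < m then v (k + 2)
    else -(B (k + 1) * tridiagonalExtend A B C m v (k + 1) + C k * tridiagonalExtend A B C m v k) /
      A (k + 1)

variable {A B C : ℕ → K} {m : ℕ}

lemma tridiagonalExtend_of_le (v : ℕ → K) {k : ℕ} (hk : k ≤ m + 1) :
    tridiagonalExtend A B C m v k = v k := by
  rcases k with _ | _ | k
  · simp [tridiagonalExtend]
  · simp [tridiagonalExtend]
  · simp [tridiagonalExtend, show k < m by omega]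

lemma tridiagonalOp_tridiagonalExtend {v : ℕ → K} (hv : ∀ k ≤ m, tridiagonalOp A B C v k = 0)
    (hA : ∀ k, m < k → A k ≠ 0) : tridiagonalOp A B C (tridiagonalExtend A B C m v) = 0 := by
  funext k
  rcases le_or_gt k m with hk | hk
  · exact (tridiagonalOp_congr fun j hj => tridiagonalExtend_of_le v (by omega)).trans (hv k hk)
  · obtain ⟨k, rfl⟩ := Nat.exists_eq_succ_of_ne_zero (Nat.ne_zero_of_lt hk)
    rw [tridiagonalOp, tridiagonalExtend, if_neg (by omega), mul_div_cancel₀ _ (hA _ hk)]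
    simp

end TridiagonalExtend

section Radius

open Asymptotics Filter

variable {𝕜 : Type*} [NontriviallyNormedField 𝕜]

lemma radius_ofScalars_pos_of_norm_le {u : ℕ → 𝕜} {K : ℝ}
    (h : ∀ᶠ n in atTop, ‖u (n + 2)‖ ≤ K * (‖u (n + 1)‖ + ‖u n‖)) :
    0 < (FormalMultilinearSeries.ofScalars 𝕜 u).radius := by
  let r : NNReal := (2 * (‖K‖₊ + 1))⁻¹
  have hr : 0 < r := by positivity
  have hKr : |K| * r + r = 2⁻¹ := by
    have hr' : (r : ℝ) = (2 * (|K| + 1))⁻¹ := by simp [r]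
    rw [hr']
    field_simp
  have hsum : Summable fun n => (‖u (n + 1)‖ + ‖u n‖) * (r : ℝ) ^ n := by
    refine summable_of_ratio_norm_eventually_le (r := 2⁻¹) (by norm_num) ?_
    filter_upwards [h] with n hn
    have hu : ‖u (n + 2)‖ + ‖u (n + 1)‖ ≤ (|K| + 1) * (‖u (n + 1)‖ + ‖u n‖) := by
      nlinarith [le_abs_self K, norm_nonneg (u (n + 1)), norm_nonneg (u n)]
    rw [Real.norm_of_nonneg (by positivity), Real.norm_of_nonneg (by positivity)]
    calc (‖u (n + 2)‖ + ‖u (n + 1)‖) * (r : ℝ) ^ (n + 1)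
        ≤ (|K| + 1) * (‖u (n + 1)‖ + ‖u n‖) * (r : ℝ) ^ (n + 1) := by gcongr
      _ = (|K| * r + r) * ((‖u (n + 1)‖ + ‖u n‖) * (r : ℝ) ^ n) := by ring
      _ = 2⁻¹ * ((‖u (n + 1)‖ + ‖u n‖) * (r : ℝ) ^ n) := by rw [hKr]
  refine (ENNReal.coe_pos.2 hr).trans_le
    (FormalMultilinearSeries.le_radius_of_summable_norm _ ?_)
  refine hsum.of_nonneg_of_le (fun n => by positivity) fun n => ?_
  rw [FormalMultilinearSeries.ofScalars_norm]
  gcongr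
  exact le_add_of_nonneg_left (norm_nonneg _)

lemma radius_ofScalars_pos_of_tridiagonalOp_eq_zero {A B C c : ℕ → 𝕜} (hA : ∀ᶠ n in atTop, A n ≠ 0)
    (hB : B =O[atTop] A) (hC : C =O[atTop] fun n => A (n + 1))
    (hc : ∀ᶠ n in atTop, tridiagonalOp A B C c n = 0) :
    0 < (FormalMultilinearSeries.ofScalars 𝕜 c).radius := by
  obtain ⟨K, hK⟩ := (hB.comp_tendsto (tendsto_add_atTop_nat 1)).bound
  obtain ⟨L, hL⟩ := hC.bound
  refine radius_ofScalars_pos_of_norm_le (K := max K L) ?_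
  have hsucc := tendsto_add_atTop_nat 1
  filter_upwards [hK, hL, hsucc.eventually hA, hsucc.eventually hc] with n hKn hLn hAn hcn
  simp only [Function.comp_apply] at hKn
  have hrec : A (n + 1) * c (n + 2) = -(B (n + 1) * c (n + 1) + C n * c n) := by
    rw [tridiagonalOp] at hcn
    linear_combination hcn
  refine le_of_mul_le_mul_left ?_ (norm_pos_iff.2 hAn)
  calc ‖A (n + 1)‖ * ‖c (n + 2)‖ = ‖B (n + 1) * c (n + 1) + C n * c n‖ := by
        rw [← norm_mul, hrec, norm_neg]
    _ ≤ ‖B (n + 1)‖ * ‖c (n + 1)‖ + ‖C n‖ * ‖c n‖ := by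
        simpa only [norm_mul] using norm_add_le (B (n + 1) * c (n + 1)) (C n * c n)
    _ ≤ max K L * ‖A (n + 1)‖ * ‖c (n + 1)‖ + max K L * ‖A (n + 1)‖ * ‖c n‖ := by
        gcongr
        · exact hKn.trans (by gcongr; exact le_max_left K L)
        · exact hLn.trans (by gcongr; exact le_max_right K L)
    _ = ‖A (n + 1)‖ * (max K L * (‖c (n + 1)‖ + ‖c n‖)) := by ring

end Radius

section Growth

open Asymptotics Filter

variable {𝕜 : Type*} [RCLike 𝕜]

lemma const_isLittleO_natCast (a : 𝕜) : (fun _ : ℕ => a) =o[atTop] fun n : ℕ => (n : 𝕜) :=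
  isLittleO_const_left.2 <| .inr <| by
    simpa [Function.comp_def] using tendsto_natCast_atTop_atTop (R := ℝ)

lemma natCast_add_isTheta (a : 𝕜) :
    (fun n : ℕ => (n : 𝕜) + a) =Θ[atTop] fun n : ℕ => (n : 𝕜) :=
  (const_isLittleO_natCast a).right_isTheta_add'.symm

end Growth

section Deriv

variable {𝕜 F : Type*} [NontriviallyNormedField 𝕜] [NormedAddCommGroup F] [NormedSpace 𝕜 F]
  [CompleteSpace F]

lemma exists_hasFPowerSeriesOnBall_deriv {f : 𝕜 → F} {p : FormalMultilinearSeries 𝕜 𝕜 F} {t : 𝕜}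
    {r : ENNReal} (hf : HasFPowerSeriesOnBall f p t r) :
    ∃ p' : FormalMultilinearSeries 𝕜 𝕜 F, HasFPowerSeriesOnBall (deriv f) p' t r ∧
      ∀ n, p'.coeff n = (n + 1) • p.coeff (n + 1) :=
  ⟨_, (ContinuousLinearMap.apply 𝕜 F (1 : 𝕜)).comp_hasFPowerSeriesOnBall hf.fderiv,
    p.derivSeries_coeff_one⟩

end Deriv

section PowerSeries

open Filter Topology

variable {𝕜 : Type*} [NontriviallyNormedField 𝕜]

lemma hasSum_coeff_mul_pow {f : 𝕜 → 𝕜} {p : FormalMultilinearSeries 𝕜 𝕜 𝕜} {t : 𝕜}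
    {r : ENNReal} (hf : HasFPowerSeriesOnBall f p t r) {x : 𝕜} (hx : x ∈ Metric.eball (0 : 𝕜) r) :
    HasSum (fun n => p.coeff n * x ^ n) (f (t + x)) := by
  simpa [FormalMultilinearSeries.apply_eq_pow_smul_coeff, mul_comm] using hf.hasSum hx

lemma hasSum_mul_pow_of_hasSum_succ {a : ℕ → 𝕜} {x s : 𝕜}
    (h : HasSum (fun n => a (n + 1) * x ^ n) s) :
    HasSum (fun n => a n * x ^ n) (a 0 + x * s) := by
  rw [← hasSum_nat_add_iff' 1]
  simpa [pow_succ', mul_left_comm] using h.mul_left x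

section EulerOperator

variable [CompleteSpace 𝕜] {f : 𝕜 → 𝕜} {p : FormalMultilinearSeries 𝕜 𝕜 𝕜} {t x : 𝕜} {r : ENNReal}

lemma hasSum_deriv (hf : HasFPowerSeriesOnBall f p t r) (hx : x ∈ Metric.eball (0 : 𝕜) r) :
    HasSum (fun n : ℕ => (n + 1) * p.coeff (n + 1) * x ^ n) (deriv f (t + x)) := by
  obtain ⟨p', hf', hp'⟩ := exists_hasFPowerSeriesOnBall_deriv hf
  simpa [hp'] using hasSum_coeff_mul_pow hf' hx

lemma hasSum_mul_deriv (hf : HasFPowerSeriesOnBall f p t r) (hx : x ∈ Metric.eball (0 : 𝕜) r) :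
    HasSum (fun n : ℕ => n * p.coeff n * x ^ n) (x * deriv f (t + x)) := by
  simpa using hasSum_mul_pow_of_hasSum_succ (a := fun n => n * p.coeff n)
    (by simpa using hasSum_deriv hf hx)

lemma hasSum_mul_deriv_deriv (hf : HasFPowerSeriesOnBall f p t r)
    (hx : x ∈ Metric.eball (0 : 𝕜) r) :
    HasSum (fun n : ℕ => (n + 1) * n * p.coeff (n + 1) * x ^ n)
      (x * deriv (deriv f) (t + x)) := by
  obtain ⟨p', hf', hp'⟩ := exists_hasFPowerSeriesOnBall_deriv hf
  simpa [hp', mul_assoc, mul_left_comm] using hasSum_mul_deriv hf' hx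

lemma hasSum_sq_mul_deriv_deriv (hf : HasFPowerSeriesOnBall f p t r)
    (hx : x ∈ Metric.eball (0 : 𝕜) r) :
    HasSum (fun n : ℕ => n * (n - 1) * p.coeff n * x ^ n) (x ^ 2 * deriv (deriv f) (t + x)) := by
  simpa [sq, mul_assoc] using hasSum_mul_pow_of_hasSum_succ (a := fun n => n * (n - 1) * p.coeff n)
    (by simpa using hasSum_mul_deriv_deriv hf hx)

end EulerOperator

lemma hasSum_tridiagonalOp_mul_pow {A B C c : ℕ → 𝕜} {x a b d : 𝕜}
    (hA : HasSum (fun n => A n * c (n + 1) * x ^ n) a) (hB : HasSum (fun n => B n * c n * x ^ n) b)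
    (hC : HasSum (fun n => C n * c n * x ^ n) d) :
    HasSum (fun n => tridiagonalOp A B C c n * x ^ n) (a + b + x * d) := by
  have hC' : HasSum (fun n => tridiagonalOp 0 0 C c n * x ^ n) (x * d) := by
    simpa [tridiagonalOp] using hasSum_mul_pow_of_hasSum_succ (a := tridiagonalOp 0 0 C c)
      (by simpa [tridiagonalOp] using hC)
  refine ((hA.add hB).add hC').congr_fun fun n => ?_
  rcases n with _ | n <;> simp only [tridiagonalOp, Pi.zero_apply] <;> ring

lemma coeff_eq_zero_of_hasSum {a : ℕ → 𝕜} {F : 𝕜 → 𝕜} {t : 𝕜} {r : ENNReal} (hr : 0 < r)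
    (ha : ∀ x ∈ Metric.eball (0 : 𝕜) r, HasSum (fun n => a n * x ^ n) (F (t + x)))
    (hF : ∀ᶠ z in 𝓝[≠] t, F z = 0) : a = 0 := by
  have h : HasFPowerSeriesAt F (FormalMultilinearSeries.ofScalars 𝕜 a) t := by
    rw [hasFPowerSeriesAt_iff]
    filter_upwards [Metric.eball_mem_nhds (0 : 𝕜) hr] with x hx
    simpa [mul_comm] using ha x hx
  have hz := h.analyticAt.frequently_zero_iff_eventually_zero.1 hF.frequently
  exact (FormalMultilinearSeries.ofScalars_series_eq_zero _).1 (h.congr hz).eq_zero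

lemma exists_analyticAt_eventuallyEq_pow_mul {f : 𝕜 → 𝕜} {p : FormalMultilinearSeries 𝕜 𝕜 𝕜} {t : 𝕜}
    {n : ℕ} (hf : HasFPowerSeriesAt f p t) (hlt : ∀ k < n, p.coeff k = 0) (hn : p.coeff n ≠ 0) :
    ∃ h : 𝕜 → 𝕜, AnalyticAt 𝕜 h t ∧ h t ≠ 0 ∧ f =ᶠ[𝓝 t] fun w => (w - t) ^ n * h w := by
  simp only [ne_eq, FormalMultilinearSeries.coeff_eq_zero] at hlt hn
  classical
  have hp : p ≠ 0 := fun h => hn (by simp [h])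
  have hord : p.order = n := by
    rw [FormalMultilinearSeries.order_eq_find' hp]
    exact (Nat.find_eq_iff _).2 ⟨hn, fun k hk => not_not.2 (hlt k hk)⟩
  refine ⟨_, (hf.has_fpower_series_iterate_dslope_fslope n).analyticAt,
    hord ▸ hf.iterate_dslope_fslope_ne_zero hp, ?_⟩
  exact hord ▸ Eventually.of_forall fun z => hf.eq_pow_order_mul_iterate_dslope z

lemma exists_polynomial_taylor_coeff_eq {R : Type*} [CommRing R] {n : ℕ} {c : ℕ → R}
    (hc : ∀ k, n < k → c k = 0) (t : R) :
    ∃ p : Polynomial R, (Polynomial.taylor t p).coeff = c := by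
  let P : Polynomial R := ∑ i ∈ Finset.range (n + 1), Polynomial.monomial i (c i)
  have hP : P.coeff = c := by
    funext k
    simp only [P, Polynomial.finsetSum_coeff, Polynomial.coeff_monomial, Finset.sum_ite_eq',
      Finset.mem_range]
    split_ifs with hk
    · rfl
    · exact (hc k (by omega)).symm
  exact ⟨Polynomial.taylor (-t) P, by
    rw [Polynomial.taylor_taylor, add_neg_cancel, Polynomial.taylor_zero, hP]⟩

lemma exists_hasFPowerSeriesOnBall_eval (p : Polynomial 𝕜) (t : 𝕜) :
    ∃ s : FormalMultilinearSeries 𝕜 𝕜 𝕜,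
      HasFPowerSeriesOnBall (fun w => p.eval w) s t ⊤ ∧
        s.coeff = (Polynomial.taylor t p).coeff := by
  refine ⟨.ofScalars 𝕜 (Polynomial.taylor t p).coeff, ⟨?_, ENNReal.zero_lt_top, fun {x} _ => ?_⟩,
    funext fun _ => FormalMultilinearSeries.coeff_ofScalars⟩
  · refine (FormalMultilinearSeries.radius_eq_top_of_forall_image_add_eq_zero _
      ((Polynomial.taylor t p).natDegree + 1) fun k => ?_).ge
    refine FormalMultilinearSeries.ofScalars_eq_zero_of_scalar_zero _ ?_
    exact Polynomial.coeff_eq_zero_of_natDegree_lt (by omega)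
  · rw [add_comm t x, ← Polynomial.taylor_eval, Polynomial.eval_eq_sum_range]
    simp only [FormalMultilinearSeries.ofScalars_apply_eq, smul_eq_mul]
    refine hasSum_sum_of_ne_finset_zero fun k hk => ?_
    rw [Polynomial.coeff_eq_zero_of_natDegree_lt (by simpa using hk), zero_mul]

end PowerSeries

lemma natCast_add_intCast_eq_zero_iff {R : Type*} [Ring R] [CharZero R] {n : ℕ} {k : ℤ} :
    (n : R) + k = 0 ↔ k = -n := by
  rw [← Int.cast_natCast, ← Int.cast_add, Int.cast_eq_zero]
  omega

section Heun

open Asymptotics Filter Topology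

variable {α β γ δ ε t q : ℂ}

/-- The superdiagonal of Heun's operator on Taylor coefficients at `t`. -/
def heunUpper (ε t : ℂ) (n : ℕ) : ℂ :=
  (n + 1) * (n + ε) * (t * (t - 1))

/-- The diagonal of Heun's operator on Taylor coefficients at `t`. -/
def heunDiag (α β γ δ ε t q : ℂ) (n : ℕ) : ℂ :=
  n * (n - 1) * (2 * t - 1) + n * ((γ + δ + 2 * ε) * t - γ - ε) + (α * β * t - q)

/-- The subdiagonal of Heun's operator on Taylor coefficients at `t`, indexed by columns. -/
def heunLower (α β : ℂ) (n : ℕ) : ℂ :=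
  (n + α) * (n + β)

/-- Heun's operator cleared of denominators: `z * (z - 1) * (z - t)` times `heunLHS` away from the
singularities, but defined there as well. -/
noncomputable def heunOp (α β γ δ ε t q : ℂ) (y : ℂ → ℂ) (z : ℂ) : ℂ :=
  z * (z - 1) * (z - t) * deriv (deriv y) z
    + (γ * ((z - 1) * (z - t)) + δ * (z * (z - t)) + ε * (z * (z - 1))) * deriv y z
    + (α * β * z - q) * y z

/-- Heun's operator on Taylor coefficients at `t`; it represents `heunOp` only under the Fuchs
relation `γ + δ + ε = α + β + 1`. -/
abbrev heunTaylorOp (α β γ δ ε t q : ℂ) (c : ℕ → ℂ) : ℕ → ℂ :=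
  tridiagonalOp (heunUpper ε t) (heunDiag α β γ δ ε t q) (heunLower α β) c

lemma heunUpper_eq_zero_iff {ε : ℤ} (ht0 : t ≠ 0) (ht1 : t ≠ 1) {n : ℕ} :
    heunUpper ε t n = 0 ↔ ε = -n := by
  simp [heunUpper, ht0, sub_eq_zero, ht1, Nat.cast_add_one_ne_zero,
    natCast_add_intCast_eq_zero_iff]

lemma heunLower_eq_zero_iff {α : ℤ} (hβ : ∀ k : ℤ, k ≤ 0 → β ≠ k) {n : ℕ} :
    heunLower α β n = 0 ↔ α = -n := by
  have hβn : (n : ℂ) + β ≠ 0 := fun h => hβ (-n) (by omega) (by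
    push_cast
    linear_combination h)
  simp [heunLower, natCast_add_intCast_eq_zero_iff, hβn]

lemma eval_heunCoeff (n : ℕ) :
    (heunCoeff α β γ δ ε t n).eval q = (-1) ^ n *
      (tridiagonal (heunUpper ε t) (heunDiag α β γ δ ε t q) (heunLower α β) n).det := by
  induction n using Nat.twoStepInduction with
  | zero => simp [heunCoeff]
  | one => simp [heunCoeff, heunDiag]
  | more n ih ih' =>
    simp only [heunCoeff, Polynomial.eval_sub, Polynomial.eval_mul, Polynomial.eval_X,
      Polynomial.eval_C, ih, ih', det_tridiagonal_add_two, heunUpper, heunDiag, heunLower]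
    push_cast
    ring

lemma eval_heunCoeff_eq_zero_iff {n : ℕ} :
    (heunCoeff α β γ δ ε t n).eval q = 0 ↔
      (tridiagonal (heunUpper ε t) (heunDiag α β γ δ ε t q) (heunLower α β) n).det = 0 := by
  simp [eval_heunCoeff]

lemma eval_heunCoeff_eq_zero_of_le {n k : ℕ} (hn : heunUpper ε t n * heunLower α β n = 0)
    (h : (heunCoeff α β γ δ ε t (n + 1)).eval q = 0) (hk : n + 1 ≤ k) :
    (heunCoeff α β γ δ ε t k).eval q = 0 := by
  rw [eval_heunCoeff_eq_zero_iff] at h ⊢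
  exact det_tridiagonal_eq_zero_of_le hn h hk

lemma heunLHS_eq_zero_iff {y : ℂ → ℂ} {z : ℂ} (h0 : z ≠ 0) (h1 : z ≠ 1) (ht : z ≠ t) :
    heunLHS α β γ δ ε t q y z = 0 ↔ heunOp α β γ δ ε t q y z = 0 := by
  have h1' := sub_ne_zero.2 h1
  have ht' := sub_ne_zero.2 ht
  have hop : heunOp α β γ δ ε t q y z = z * (z - 1) * (z - t) * heunLHS α β γ δ ε t q y z := by
    unfold heunOp heunLHS
    field_simp
  simp [hop, h0, h1', ht']

lemma heunLHS_congr {f g : ℂ → ℂ} {z : ℂ} (h : f =ᶠ[𝓝 z] g) :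
    heunLHS α β γ δ ε t q f z = heunLHS α β γ δ ε t q g z := by
  simp only [heunLHS, h.deriv.deriv_eq, h.deriv_eq, h.eq_of_nhds]

lemma eventually_ne_singular (ht0 : t ≠ 0) (ht1 : t ≠ 1) :
    ∀ᶠ z in 𝓝[≠] t, z ≠ 0 ∧ z ≠ 1 ∧ z ≠ t :=
  (eventually_ne_nhdsWithin ht0).and ((eventually_ne_nhdsWithin ht1).and eventually_mem_nhdsWithin)

section PowerSeries

variable {f : ℂ → ℂ} {p : FormalMultilinearSeries ℂ ℂ ℂ} {r : ENNReal}

lemma heunOp_add (hsum : γ + δ + ε = α + β + 1) (x : ℂ) :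
    heunOp α β γ δ ε t q f (t + x) =
      t * (t - 1) * (x * deriv (deriv f) (t + x) + ε * deriv f (t + x))
        + ((2 * t - 1) * (x ^ 2 * deriv (deriv f) (t + x))
          + ((γ + δ + 2 * ε) * t - γ - ε) * (x * deriv f (t + x)) + (α * β * t - q) * f (t + x))
        + x * (x ^ 2 * deriv (deriv f) (t + x) + (α + β + 1) * (x * deriv f (t + x))
          + α * β * f (t + x)) := by
  rw [heunOp]
  linear_combination (x ^ 2 * deriv f (t + x)) * hsum

lemma hasSum_heunOp (hsum : γ + δ + ε = α + β + 1) (hf : HasFPowerSeriesOnBall f p t r) {x : ℂ}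
    (hx : x ∈ Metric.eball (0 : ℂ) r) :
    HasSum (fun n => heunTaylorOp α β γ δ ε t q p.coeff n * x ^ n)
      (heunOp α β γ δ ε t q f (t + x)) := by
  have hf0 := hasSum_coeff_mul_pow hf hx
  have hf1 := hasSum_deriv hf hx
  have hxf1 := hasSum_mul_deriv hf hx
  have hxf2 := hasSum_mul_deriv_deriv hf hx
  have hxxf2 := hasSum_sq_mul_deriv_deriv hf hx
  rw [heunOp_add hsum]
  refine hasSum_tridiagonalOp_mul_pow ?_ ?_ ?_
  · refine ((hxf2.add (hf1.mul_left ε)).mul_left (t * (t - 1))).congr_fun fun n => ?_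
    rw [heunUpper]
    ring
  · refine (((hxxf2.mul_left _).add (hxf1.mul_left _)).add (hf0.mul_left _)).congr_fun fun n => ?_
    rw [heunDiag]
    ring
  · refine ((hxxf2.add (hxf1.mul_left _)).add (hf0.mul_left _)).congr_fun fun n => ?_
    rw [heunLower]
    ring

lemma heunOp_eq_zero_of_heunTaylorOp_eq_zero (hsum : γ + δ + ε = α + β + 1)
    (hf : HasFPowerSeriesOnBall f p t r) (h : heunTaylorOp α β γ δ ε t q p.coeff = 0) {z : ℂ}
    (hz : z ∈ Metric.eball t r) : heunOp α β γ δ ε t q f z = 0 := by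
  have hx : z - t ∈ Metric.eball (0 : ℂ) r := by simpa [edist_eq_enorm_sub] using hz
  have hs := hasSum_heunOp (q := q) hsum hf hx
  simp only [h, Pi.zero_apply, zero_mul, add_sub_cancel] at hs
  exact hs.unique hasSum_zero

lemma eventually_heunLHS_eq_zero_iff (ht0 : t ≠ 0) (ht1 : t ≠ 1) (hsum : γ + δ + ε = α + β + 1)
    (hf : HasFPowerSeriesAt f p t) :
    (∀ᶠ z in 𝓝[≠] t, heunLHS α β γ δ ε t q f z = 0) ↔ heunTaylorOp α β γ δ ε t q p.coeff = 0 := by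
  obtain ⟨r, hf⟩ := hf
  constructor <;> intro h
  · refine coeff_eq_zero_of_hasSum hf.r_pos (fun x hx => hasSum_heunOp hsum hf hx) ?_
    filter_upwards [h, eventually_ne_singular ht0 ht1] with z hz ⟨h0, h1, ht⟩
    exact (heunLHS_eq_zero_iff h0 h1 ht).1 hz
  · filter_upwards [nhdsWithin_le_nhds (Metric.eball_mem_nhds t hf.r_pos),
      eventually_ne_singular ht0 ht1] with z hz ⟨h0, h1, ht⟩
    exact (heunLHS_eq_zero_iff h0 h1 ht).2 (heunOp_eq_zero_of_heunTaylorOp_eq_zero hsum hf h hz)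

end PowerSeries

lemma heunUpper_isTheta (ht0 : t ≠ 0) (ht1 : t ≠ 1) :
    heunUpper ε t =Θ[atTop] fun n => (n : ℂ) * n := by
  have hT : t * (t - 1) ≠ 0 := mul_ne_zero ht0 (sub_ne_zero.2 ht1)
  have hfun : heunUpper ε t = fun n : ℕ => t * (t - 1) * ((n + 1) * (n + ε)) :=
    funext fun n => mul_comm _ _
  rw [hfun]
  exact ((natCast_add_isTheta 1).mul (natCast_add_isTheta ε)).const_mul_left hT

lemma heunDiag_isBigO : heunDiag α β γ δ ε t q =O[atTop] fun n => (n : ℂ) * n := by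
  have hn : (fun n : ℕ => (n : ℂ)) =O[atTop] fun n : ℕ => (n : ℂ) := isBigO_refl _ _
  have h1 := (const_isLittleO_natCast (1 : ℂ)).isBigO
  refine (((((hn.mul (natCast_add_isTheta (-1)).isBigO).const_mul_left (2 * t - 1)).add
    ((hn.mul h1).const_mul_left ((γ + δ + 2 * ε) * t - γ - ε))).add
    ((h1.mul h1).const_mul_left (α * β * t - q)))).congr_left fun n => ?_
  rw [heunDiag]
  ring

lemma heunLower_isBigO : heunLower α β =O[atTop] fun n => (n : ℂ) * n :=
  (natCast_add_isTheta α).isBigO.mul (natCast_add_isTheta β).isBigO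

lemma heunTaylorOp_radius_pos (ht0 : t ≠ 0) (ht1 : t ≠ 1) {c : ℕ → ℂ}
    (h : heunTaylorOp α β γ δ ε t q c = 0) :
    0 < (FormalMultilinearSeries.ofScalars ℂ c).radius := by
  have hA := heunUpper_isTheta (ε := ε) ht0 ht1
  have hA' : (fun n => heunUpper ε t (n + 1)) =Θ[atTop] fun n => (n : ℂ) * n := by
    have hsucc := tendsto_add_atTop_nat 1
    refine IsTheta.trans ⟨hA.1.comp_tendsto hsucc, hA.2.comp_tendsto hsucc⟩ ?_
    simpa [Function.comp_def] using (natCast_add_isTheta (1 : ℂ)).mul (natCast_add_isTheta 1)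
  refine radius_ofScalars_pos_of_tridiagonalOp_eq_zero ?_
    (heunDiag_isBigO.trans hA.symm.isBigO) (heunLower_isBigO.trans hA'.symm.isBigO)
    (.of_forall (congrFun h))
  filter_upwards [hA.eq_zero_iff, eventually_ne_atTop 0] with n hn h0
  simpa [h0] using hn.not

lemma exists_heunSolution_of_heunTaylorOp_eq_zero (ht0 : t ≠ 0) (ht1 : t ≠ 1)
    (hsum : γ + δ + ε = α + β + 1) {c : ℕ → ℂ} (h : heunTaylorOp α β γ δ ε t q c = 0) :
    ∃ (f : ℂ → ℂ) (p : FormalMultilinearSeries ℂ ℂ ℂ), HasFPowerSeriesAt f p t ∧ p.coeff = c ∧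
      ∀ᶠ z in 𝓝[≠] t, heunLHS α β γ δ ε t q f z = 0 := by
  have hf := ((FormalMultilinearSeries.ofScalars ℂ c).hasFPowerSeriesOnBall
    (heunTaylorOp_radius_pos ht0 ht1 h)).comp_sub t
  rw [zero_add] at hf
  have hc : (FormalMultilinearSeries.ofScalars ℂ c).coeff = c :=
    funext fun _ => FormalMultilinearSeries.coeff_ofScalars
  exact ⟨_, _, hf.hasFPowerSeriesAt, hc,
    (eventually_heunLHS_eq_zero_iff ht0 ht1 hsum hf.hasFPowerSeriesAt).2 (by rwa [hc])⟩

lemma exists_heunSolution_extending {ε : ℤ} {m : ℕ} (hm : ε = -m) (ht0 : t ≠ 0) (ht1 : t ≠ 1)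
    (hsum : γ + δ + ε = α + β + 1) {v : ℕ → ℂ}
    (hv : ∀ k ≤ m, heunTaylorOp α β γ δ ε t q v k = 0) :
    ∃ (f : ℂ → ℂ) (p : FormalMultilinearSeries ℂ ℂ ℂ), HasFPowerSeriesAt f p t ∧
      (∀ k ≤ m + 1, p.coeff k = v k) ∧
      ∀ᶠ z in 𝓝[≠] t, heunLHS α β γ δ ε t q f z = 0 := by
  have hA (k : ℕ) (hk : m < k) : heunUpper ε t k ≠ 0 := by
    rw [Ne, heunUpper_eq_zero_iff ht0 ht1]
    omega
  obtain ⟨f, p, hf, hp, hsol⟩ := exists_heunSolution_of_heunTaylorOp_eq_zero ht0 ht1 hsum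
    (tridiagonalOp_tridiagonalExtend hv hA)
  exact ⟨f, p, hf, fun k hk => by rw [hp, tridiagonalExtend_of_le v hk], hsol⟩

lemma exists_heunSolution_zpow_mul {ε : ℤ} (ht0 : t ≠ 0) (ht1 : t ≠ 1)
    (hsum : γ + δ + ε = α + β + 1) (hε : ε ≤ 0) :
    ∃ h : ℂ → ℂ, AnalyticAt ℂ h t ∧ h t ≠ 0 ∧
      ∀ᶠ z in 𝓝[≠] t, heunLHS α β γ δ ε t q (fun w => (w - t) ^ (1 - ε) * h w) z = 0 := by
  obtain ⟨m, hm⟩ : ∃ m : ℕ, ε = -m := ⟨(-ε).toNat, by omega⟩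
  have hupper : heunUpper ε t m = 0 := (heunUpper_eq_zero_iff ht0 ht1).2 hm
  obtain ⟨g, p, hg, hp, hsol⟩ := exists_heunSolution_extending (q := q) hm ht0 ht1 hsum
    (v := Pi.single (m + 1) 1)
    fun k hk => tridiagonalOp_eq_zero_of_le hupper (fun j hj => by simp [hj.ne]) hk
  obtain ⟨h, hh, hht, hgh⟩ := exists_analyticAt_eventuallyEq_pow_mul hg (n := m + 1)
    (fun k hk => by rw [hp k hk.le, Pi.single_eq_of_ne hk.ne]) (by simp [hp])
  refine ⟨h, hh, hht, ?_⟩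
  filter_upwards [hsol, nhdsWithin_le_nhds hgh.eventually_nhds] with z hz hgz
  simp only [show 1 - ε = ((m + 1 : ℕ) : ℤ) by omega, zpow_natCast]
  rw [← hz]
  exact (heunLHS_congr hgz).symm

lemma exists_heunSolution_ne_zero_iff {ε : ℤ} {m : ℕ} (hm : ε = -m) (ht0 : t ≠ 0) (ht1 : t ≠ 1)
    (hsum : γ + δ + ε = α + β + 1) :
    (∃ f : ℂ → ℂ, AnalyticAt ℂ f t ∧ f t ≠ 0 ∧
      ∀ᶠ z in 𝓝[≠] t, heunLHS α β γ δ ε t q f z = 0) ↔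
      (heunCoeff α β γ δ ε t (m + 1)).eval q = 0 := by
  rw [eval_heunCoeff_eq_zero_iff]
  constructor
  · rintro ⟨f, ⟨p, hf⟩, hft, hsol⟩
    have hop := (eventually_heunLHS_eq_zero_iff ht0 ht1 hsum hf).1 hsol
    have hp0 : p.coeff 0 ≠ 0 := by
      rwa [show p.coeff 0 = f t from hf.coeff_zero _]
    refine det_tridiagonal_eq_zero_of_tridiagonalOp_eq_zero ?_ (fun i _ => congrFun hop i)
      m.zero_le hp0
    rw [(heunUpper_eq_zero_iff ht0 ht1).2 hm, zero_mul]
  · intro hdet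
    obtain ⟨c, ⟨k, hkm, hck⟩, -, hop⟩ := exists_tridiagonalOp_eq_zero hdet
    have hc0 : c 0 ≠ 0 := by
      refine fun h0 => hck (eq_zero_of_tridiagonalOp_eq_zero (fun i hi => ?_)
        (fun i hi => hop i hi.le) h0 hkm)
      rw [Ne, heunUpper_eq_zero_iff ht0 ht1]
      omega
    obtain ⟨f, p, hf, hp, hsol⟩ := exists_heunSolution_extending hm ht0 ht1 hsum hop
    refine ⟨f, hf.analyticAt, ?_, hsol⟩
    rwa [show f t = p.coeff 0 from (hf.coeff_zero _).symm, hp 0 (Nat.zero_le _)]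

theorem isApparentAt_iff {ε : ℤ} (ht0 : t ≠ 0) (ht1 : t ≠ 1) (hsum : γ + δ + ε = α + β + 1)
    (hε : ε ≤ 0) : IsApparentAt α β γ δ ε t q ↔ (heunPApp α β γ δ ε t).eval q = 0 := by
  rw [heunPApp, show (1 - ε).toNat = (-ε).toNat + 1 by omega,
    ← exists_heunSolution_ne_zero_iff (by omega) ht0 ht1 hsum]
  constructor
  · rintro ⟨f, -, hf, hft, -, -, hsol, -⟩
    exact ⟨f, hf, hft, hsol⟩
  · rintro ⟨f, hf, hft, hsol⟩
    obtain ⟨h, hh, hht, hhsol⟩ := exists_heunSolution_zpow_mul ht0 ht1 hsum hε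
    exact ⟨f, h, hf, hft, hh, hht, hsol, hhsol⟩

lemma forall_heunLHS_eval_eq_zero_iff (ht0 : t ≠ 0) (ht1 : t ≠ 1)
    (hsum : γ + δ + ε = α + β + 1) {p : Polynomial ℂ} :
    (∀ z : ℂ, z ≠ 0 → z ≠ 1 → z ≠ t → heunLHS α β γ δ ε t q (fun w => p.eval w) z = 0) ↔
      heunTaylorOp α β γ δ ε t q (Polynomial.taylor t p).coeff = 0 := by
  obtain ⟨s, hs, hsp⟩ := exists_hasFPowerSeriesOnBall_eval p t
  rw [← hsp]
  constructor
  · intro hsol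
    rw [← eventually_heunLHS_eq_zero_iff ht0 ht1 hsum hs.hasFPowerSeriesAt]
    filter_upwards [eventually_ne_singular ht0 ht1] with z ⟨h0, h1, ht⟩
    exact hsol z h0 h1 ht
  · intro hop z h0 h1 ht
    rw [heunLHS_eq_zero_iff h0 h1 ht]
    exact heunOp_eq_zero_of_heunTaylorOp_eq_zero hsum hs hop (by simp)

lemma heunLower_natDegree_eq_zero {P : Polynomial ℂ} (hP : P ≠ 0)
    (h : heunTaylorOp α β γ δ ε t q P.coeff = 0) : heunLower α β P.natDegree = 0 := by
  simpa [tridiagonalOp, Polynomial.coeff_eq_zero_of_natDegree_lt, hP] using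
    congrFun h (P.natDegree + 1)

theorem hasPolynomialSolution_iff {α : ℤ} (ht0 : t ≠ 0) (ht1 : t ≠ 1)
    (hsum : γ + δ + ε = α + β + 1) (hα : α ≤ 0) (hβ : ∀ k : ℤ, k ≤ 0 → β ≠ k) :
    HasPolynomialSolution α β γ δ ε t q ↔ (heunPPol α β γ δ ε t).eval q = 0 := by
  obtain ⟨n, hn⟩ : ∃ n : ℕ, α = -n := ⟨(-α).toNat, by omega⟩
  simp only [HasPolynomialSolution, forall_heunLHS_eval_eq_zero_iff ht0 ht1 hsum]
  rw [heunPPol, show (1 - α).toNat = n + 1 by omega, eval_heunCoeff_eq_zero_iff]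
  constructor
  · rintro ⟨p, hp, hop⟩
    set P := Polynomial.taylor t p with hP
    have hP0 : P ≠ 0 := by simpa [hP] using hp
    have hdeg : P.natDegree = n := by
      have := (heunLower_eq_zero_iff hβ).1 (heunLower_natDegree_eq_zero hP0 hop)
      omega
    have hlead : P.coeff n ≠ 0 := hdeg ▸ Polynomial.leadingCoeff_ne_zero.2 hP0
    refine det_tridiagonal_eq_zero_of_tridiagonalOp_eq_zero ?_ (fun i _ => congrFun hop i)
      le_rfl hlead
    rw [Polynomial.coeff_eq_zero_of_natDegree_lt (by omega), mul_zero]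
  · intro hdet
    obtain ⟨c, ⟨k, -, hck⟩, hc, hop⟩ := exists_tridiagonalOp_eq_zero hdet
    obtain ⟨p, rfl⟩ := exists_polynomial_taylor_coeff_eq hc t
    refine ⟨p, fun hp => hck (by simp [hp]), funext fun i => ?_⟩
    rcases le_or_gt i n with hi | hi
    · exact hop i hi
    · exact tridiagonalOp_eq_zero_of_lt ((heunLower_eq_zero_iff hβ).2 hn) hc hi

end Heun

theorem mainTheorem3 (α ε : ℤ) (β γ δ t q : ℂ)
    (ht0 : t ≠ 0) (ht1 : t ≠ 1)
    (hsum : γ + δ + (ε : ℂ) = (α : ℂ) + β + 1)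
    (hε : ε ≤ 0) (hα : α ≤ 0) (hβ : ∀ k : ℤ, k ≤ 0 → β ≠ (k : ℂ)) :
    -- the two algebraic conditions on the accessory parameter express the two properties
    (HasPolynomialSolution α β γ δ ε t q ↔ (heunPPol α β γ δ ε t).eval q = 0) ∧
    (IsApparentAt α β γ δ ε t q ↔ (heunPApp α β γ δ ε t).eval q = 0) ∧
    -- (i)
    (-α ≤ -ε → HasPolynomialSolution α β γ δ ε t q → IsApparentAt α β γ δ ε t q) ∧
    -- (ii)
    (-ε ≤ -α → IsApparentAt α β γ δ ε t q → HasPolynomialSolution α β γ δ ε t q) := by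
  have hpol := hasPolynomialSolution_iff (q := q) ht0 ht1 hsum hα hβ
  have happ := isApparentAt_iff (q := q) ht0 ht1 hsum hε
  have hlower : heunLower α β (-α).toNat = 0 := (heunLower_eq_zero_iff hβ).2 (by omega)
  have hupper : heunUpper ε t (-ε).toNat = 0 := (heunUpper_eq_zero_iff ht0 ht1).2 (by omega)
  refine ⟨hpol, happ, fun hle h => happ.2 ?_, fun hle h => hpol.2 ?_⟩
  · rw [hpol, heunPPol, show (1 - α).toNat = (-α).toNat + 1 by omega] at h
    exact eval_heunCoeff_eq_zero_of_le (by rw [hlower, mul_zero]) h (by omega)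
  · rw [happ, heunPApp, show (1 - ε).toNat = (-ε).toNat + 1 by omega] at h
    exact eval_heunCoeff_eq_zero_of_le (by rw [hupper, zero_mul]) h (by omega)
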